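/- Let $\mathit{Atm}$ (atomic propositions) and $\mathit{Nom}$ (nominals) be disjoint countably infinite sets, and let $\mathit{Agt}$ (agents) and $\mathit{Act}$ (actions) be finite sets. Programs $\pi$ and formulas $\varphi$ are given by $$\pi ::= {\equiv_i} \mid {\preceq_{i,\tau}} \mid {\preceq_{i,\tau}^{\sim}} \mid \pi;\pi' \mid \pi\cup\pi' \mid \pi\cap\pi' \mid -\pi \mid \varphi?,\qquad \varphi ::= p \mid x \mid \mathsf{play}(i,a) \mid \neg\varphi \mid \varphi\wedge\varphi' \mid [\pi]\varphi ,$$ with $p\in\mathit{Atm}$, $x\in\mathit{Nom}$, $i\in\mathit{Agt}$, $a\in\mathit{Act}$, $\tau\in\{P,D\}$; the other Boolean connectives are defined as usual and $\langle\pi\rangle\varphi := \neg[\pi]\neg\varphi$. A multi-agent cognitive model with choices (MCMC) consists of a set $W$ of worlds; for each agent $i$, preorders $\preceq_{i,P},\preceq_{i,D}$ and an equivalence relation $\equiv_i$ on $W$; a valuation $V:W\to 2^{\mathit{Atm}\cup\mathit{Nom}}$; and choice functions $C_i:W\to\mathit{Act}$, such that for all $i\in\mathit{Agt}$, $\tau\in\{P,D\}$,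 $w,v\in W$: (C1) ${\preceq_{i,\tau}}\subseteq{\equiv_i}$; (C2) if $w\equiv_i v$ then $w\preceq_{i,\tau}v$ or $v\preceq_{i,\tau}w$; (C3) $V(w)\cap\mathit{Nom}\neq\emptyset$; (C4) if $V(w)\cap V(v)\cap\mathit{Nom}\neq\emptyset$ then $w=v$; (C5) for every $\delta:\mathit{Agt}\to\mathit{Act}$, if for every $j\in\mathit{Agt}$ there is $w_j$ with $w\equiv_i w_j$ and $C_j(w_j)=\delta(j)$, then there is $u$ with $w\equiv_i u$ and $C_j(u)=\delta(j)$ for all $j\in\mathit{Agt}$. Truth: $p$ (respectively $x$) is true at $w$ iff it belongs to $V(w)$; $\mathsf{play}(i,a)$ is true at $w$ iff $C_i(w)=a$; $\neg,\wedge$ are classical; $[\pi]\varphi$ is true at $w$ iff $\varphi$ is true at every $v$ with $w R_\pi v$. Here $R_{\equiv_i}$ is $\equiv_i$; $R_{\preceq_{i,\tau}}$ is $\preceq_{i,\tau}$; $wR_{\preceq_{i,\tau}^{\sim}}v$ iff $w\equiv_i v$ and $w\not\preceq_{i,\tau}v$; $;,\cup,\cap,-$ are interpreted as relational composition, union, intersection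 and converse; $wR_{\varphi?}v$ iff $w=v$ and $\varphi$ is true at $w$. A formula is valid if it is true at every world of every MCMC. The set of theorems of the logic $\mathrm{DLCAG}$ is the least set of formulas that contains all instances of the following axioms and is closed under the following rules (for all formulas $\varphi,\psi$, programs $\pi,\pi'$, $x\in\mathit{Nom}$, $i\in\mathit{Agt}$, $\tau\in\{P,D\}$, $a,b\in\mathit{Act}$, $\delta:\mathit{Agt}\to\mathit{Act}$). Axioms: 1. all classical propositional tautologies; 2. $([\pi]\varphi\wedge[\pi](\varphi\to\psi))\to[\pi]\psi$; 3. $[\equiv_i]\varphi\to\varphi$; $[\equiv_i]\varphi\to[\equiv_i][\equiv_i]\varphi$; $\neg[\equiv_i]\varphi\to[\equiv_i]\neg[\equiv_i]\varphi$; 4. $[\preceq_{i,\tau}]\varphi\to\varphi$; $[\preceq_{i,\tau}]\varphi\to[\preceq_{i,\tau}][\preceq_{i,\tau}]\varphi$; $[\equiv_i]\varphi\to[\preceq_{i,\tau}]\varphi$; 5. $(\langle\equiv_i\rangle\varphi\wedge\langle\equiv_i\rangle\psi)\to(\langle\equiv_i\rangle(\varphi\wedge\langle\preceq_{i,\tau}\rangle\psi)\vee\langle\equiv_i\rangle(\psi\wedge\langle\preceq_{i,\tau}\rangle\varphi))$;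 6. $[\pi;\pi']\varphi\leftrightarrow[\pi][\pi']\varphi$; $[\pi\cup\pi']\varphi\leftrightarrow([\pi]\varphi\wedge[\pi']\varphi)$; 7. $([\pi]\varphi\wedge[\pi']\psi)\to[\pi\cap\pi'](\varphi\wedge\psi)$; $(\langle\pi\rangle x\wedge\langle\pi'\rangle x)\to\langle\pi\cap\pi'\rangle x$; 8. $\varphi\to[\pi]\langle-\pi\rangle\varphi$; $\varphi\to[-\pi]\langle\pi\rangle\varphi$; 9. $([\preceq_{i,\tau}]\varphi\wedge[\preceq_{i,\tau}^{\sim}]\varphi)\leftrightarrow[\equiv_i]\varphi$; $\langle\preceq_{i,\tau}\rangle x\to[\preceq_{i,\tau}^{\sim}]\neg x$; 10. $[\varphi?]\psi\leftrightarrow(\varphi\to\psi)$; 11. $\langle\pi\rangle(x\wedge\varphi)\to[\pi'](x\to\varphi)$; 12. (MostAct) $\mathsf{play}(i,a)\to\neg\mathsf{play}(i,b)$ if $a\neq b$; 13. (LeastAct) $\bigvee_{a\in\mathit{Act}}\mathsf{play}(i,a)$; 14. (SIC) $\bigl(\bigwedge_{j\in\mathit{Agt}}\langle\equiv_i\rangle\mathsf{play}(j,\delta(j))\bigr)\to\langle\equiv_i\rangle\bigwedge_{j\in\mathit{Agt}}\mathsf{play}(j,\delta(j))$.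 Rules: modus ponens; from $\varphi$ infer $[\pi]\varphi$; and (Cov) from $[\pi]\neg x$ for all $x\in\mathit{Nom}$ infer $[\pi]\bot$. Theorem. $\mathrm{DLCAG}$ is sound and complete for the class of multi-agent cognitive models with choices: a formula is a theorem of $\mathrm{DLCAG}$ if and only if it is valid. -/

import Mathlib

universe u₁ u₂ u₃ u₄ v

namespace DLCAG

/-- The two kinds of orderings: plausibility `P` and desirability `D`. -/
inductive Kind : Type
  | P
  | D

mutual
  /-- Cognitive programs. -/
  inductive Program (Atm : Type u₁) (Nom : Type u₂) (Agt : Type u₃) (Act : Type u₄) :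
      Type (max u₁ u₂ u₃ u₄)
    | equiv (i : Agt) : Program Atm Nom Agt Act
    | pre (i : Agt) (τ : Kind) : Program Atm Nom Agt Act
    | preCompl (i : Agt) (τ : Kind) : Program Atm Nom Agt Act
    | seq (π π' : Program Atm Nom Agt Act) : Program Atm Nom Agt Act
    | union (π π' : Program Atm Nom Agt Act) : Program Atm Nom Agt Act
    | inter (π π' : Program Atm Nom Agt Act) : Program Atm Nom Agt Act
    | conv (π : Program Atm Nom Agt Act) : Program Atm Nom Agt Act
    | test (φ : Formula Atm Nom Agt Act) : Program Atm Nom Agt Act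

  /-- Formulas: atoms, nominals, choice constants, negation, conjunction, and `[π] φ`. -/
  inductive Formula (Atm : Type u₁) (Nom : Type u₂) (Agt : Type u₃) (Act : Type u₄) :
      Type (max u₁ u₂ u₃ u₄)
    | atom (p : Atm) : Formula Atm Nom Agt Act
    | nom (x : Nom) : Formula Atm Nom Agt Act
    | play (i : Agt) (a : Act) : Formula Atm Nom Agt Act
    | neg (φ : Formula Atm Nom Agt Act) : Formula Atm Nom Agt Act
    | and (φ ψ : Formula Atm Nom Agt Act) : Formula Atm Nom Agt Act
    | box (π : Program Atm Nom Agt Act) (φ : Formula Atm Nom Agt Act) : Formula Atm Nom Agt Act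
end

namespace Formula

variable {Atm : Type u₁} {Nom : Type u₂} {Agt : Type u₃} {Act : Type u₄}

/-- `φ ∨ ψ`. -/
def or (φ ψ : Formula Atm Nom Agt Act) : Formula Atm Nom Agt Act :=
  neg (and (neg φ) (neg ψ))

/-- `φ → ψ`. -/
def imp (φ ψ : Formula Atm Nom Agt Act) : Formula Atm Nom Agt Act :=
  neg (and φ (neg ψ))

/-- `φ ↔ ψ`. -/
def iff (φ ψ : Formula Atm Nom Agt Act) : Formula Atm Nom Agt Act :=
  and (imp φ ψ) (imp ψ φ)

/-- `⟨π⟩ φ`. -/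
def dia (π : Program Atm Nom Agt Act) (φ : Formula Atm Nom Agt Act) : Formula Atm Nom Agt Act :=
  neg (box π (neg φ))

/-- `⊥`, as `p ∧ ¬ p` for a fixed (arbitrary) atom `p`. -/
noncomputable def bot [Nonempty Atm] : Formula Atm Nom Agt Act :=
  and (atom (Classical.arbitrary Atm)) (neg (atom (Classical.arbitrary Atm)))

/-- `⊤`. -/
noncomputable def top [Nonempty Atm] : Formula Atm Nom Agt Act :=
  neg bot

/-- Conjunction of the `f k`, `k ∈ s` (in some fixed order). -/
noncomputable def bigAnd [Nonempty Atm] {κ : Type*} (s : Finset κ)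
    (f : κ → Formula Atm Nom Agt Act) : Formula Atm Nom Agt Act :=
  (s.toList.map f).foldr and top

/-- Disjunction of the `f k`, `k ∈ s` (in some fixed order). -/
noncomputable def bigOr [Nonempty Atm] {κ : Type*} (s : Finset κ)
    (f : κ → Formula Atm Nom Agt Act) : Formula Atm Nom Agt Act :=
  (s.toList.map f).foldr or bot

/-- `play(δ_C)` for a joint action `δ` and a coalition `C`. -/
noncomputable def playJoint [Nonempty Atm] (δ : Agt → Act) (C : Finset Agt) :
    Formula Atm Nom Agt Act :=
  bigAnd C (fun i => play i (δ i))

/-- Instances of classical propositional tautologies: true under every assignment of truth values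
to formulas that respects `¬` and `∧`. -/
def IsTautology (φ : Formula Atm Nom Agt Act) : Prop :=
  ∀ val : Formula Atm Nom Agt Act → Prop,
    (∀ ψ, val (neg ψ) ↔ ¬ val ψ) →
    (∀ ψ χ, val (and ψ χ) ↔ (val ψ ∧ val χ)) →
    val φ

end Formula

/-- Multi-agent cognitive models. `pre i τ w v` is `w ≼_{i,τ} v`, `equiv i w v` is `w ≡_i v`. -/
structure MCM (Atm : Type u₁) (Nom : Type u₂) (Agt : Type u₃) where
  W : Type v
  pre : Agt → Kind → W → W → Prop
  equiv : Agt → W → W → Prop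
  V : W → Set (Atm ⊕ Nom)
  pre_refl : ∀ i τ w, pre i τ w w
  pre_trans : ∀ i τ w v u, pre i τ w v → pre i τ v u → pre i τ w u
  equiv_equivalence : ∀ i, Equivalence (equiv i)
  c1 : ∀ i τ w v, pre i τ w v → equiv i w v
  c2 : ∀ i τ w v, equiv i w v → pre i τ w v ∨ pre i τ v w
  c3 : ∀ w, {x : Nom | Sum.inr x ∈ V w}.Nonempty
  c4 : ∀ w v, ({x : Nom | Sum.inr x ∈ V w} ∩ {x : Nom | Sum.inr x ∈ V v}).Nonempty → w = v

/-- Multi-agent cognitive models with choices. -/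
structure MCMC (Atm : Type u₁) (Nom : Type u₂) (Agt : Type u₃) (Act : Type u₄)
    extends MCM.{u₁, u₂, u₃, v} Atm Nom Agt where
  C : Agt → W → Act
  c5 : ∀ (i : Agt) (δ : Agt → Act) (w : W),
    (∀ j, ∃ w', equiv i w w' ∧ C j w' = δ j) →
    ∃ v, equiv i w v ∧ ∀ j, C j v = δ j

section Semantics

variable {Atm : Type u₁} {Nom : Type u₂} {Agt : Type u₃} {Act : Type u₄}

mutual
  /-- The accessibility relation `R_π`. -/
  def Rel (M : MCMC.{u₁, u₂, u₃, u₄, v} Atm Nom Agt Act) :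
      Program Atm Nom Agt Act → M.W → M.W → Prop
    | .equiv i, w, v => M.equiv i w v
    | .pre i τ, w, v => M.pre i τ w v
    | .preCompl i τ, w, v => M.equiv i w v ∧ ¬ M.pre i τ w v
    | .seq π π', w, v => ∃ u, Rel M π w u ∧ Rel M π' u v
    | .union π π', w, v => Rel M π w v ∨ Rel M π' w v
    | .inter π π', w, v => Rel M π w v ∧ Rel M π' w v
    | .conv π, w, v => Rel M π v w
    | .test φ, w, v => w = v ∧ Sat M φ w

  /-- The truth conditions: `Sat M φ w` is `M, w ⊨ φ`. -/
  def Sat (M : MCMC.{u₁, u₂, u₃, u₄, v} Atm Nom Agt Act) :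
      Formula Atm Nom Agt Act → M.W → Prop
    | .atom p, w => Sum.inl p ∈ M.V w
    | .nom x, w => Sum.inr x ∈ M.V w
    | .play i a, w => M.C i w = a
    | .neg φ, w => ¬ Sat M φ w
    | .and φ ψ, w => Sat M φ w ∧ Sat M ψ w
    | .box π φ, w => ∀ v, Rel M π w v → Sat M φ v
end

end Semantics

/-- Validity in the class of all multi-agent cognitive models with choices. -/
def Valid {Atm : Type u₁} {Nom : Type u₂} {Agt : Type u₃} {Act : Type u₄}
    (φ : Formula Atm Nom Agt Act) : Prop :=
  ∀ (M : MCMC.{u₁, u₂, u₃, u₄, v} Atm Nom Agt Act) (w : M.W), Sat M φ w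

section Axioms

variable {Atm : Type u₁} {Nom : Type u₂} {Agt : Type u₃} {Act : Type u₄}

open Formula Program

/-- Instances, in the language with choice constants, of the axioms of the
Dynamic Logic of Cognitive Attitudes. -/
inductive DLCAAxiom : Formula Atm Nom Agt Act → Prop
  | taut (φ : Formula Atm Nom Agt Act) (h : φ.IsTautology) : DLCAAxiom φ
  | k (π : Program Atm Nom Agt Act) (φ ψ : Formula Atm Nom Agt Act) :
      DLCAAxiom (imp (and (box π φ) (box π (imp φ ψ))) (box π ψ))
  | t_equiv (i : Agt) (φ : Formula Atm Nom Agt Act) :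
      DLCAAxiom (imp (box (equiv i) φ) φ)
  | four_equiv (i : Agt) (φ : Formula Atm Nom Agt Act) :
      DLCAAxiom (imp (box (equiv i) φ) (box (equiv i) (box (equiv i) φ)))
  | five_equiv (i : Agt) (φ : Formula Atm Nom Agt Act) :
      DLCAAxiom (imp (neg (box (equiv i) φ)) (box (equiv i) (neg (box (equiv i) φ))))
  | t_pre (i : Agt) (τ : Kind) (φ : Formula Atm Nom Agt Act) :
      DLCAAxiom (imp (box (pre i τ) φ) φ)
  | four_pre (i : Agt) (τ : Kind) (φ : Formula Atm Nom Agt Act) :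
      DLCAAxiom (imp (box (pre i τ) φ) (box (pre i τ) (box (pre i τ) φ)))
  | inc (i : Agt) (τ : Kind) (φ : Formula Atm Nom Agt Act) :
      DLCAAxiom (imp (box (equiv i) φ) (box (pre i τ) φ))
  | conn (i : Agt) (τ : Kind) (φ ψ : Formula Atm Nom Agt Act) :
      DLCAAxiom (imp (and (dia (equiv i) φ) (dia (equiv i) ψ))
        (or (dia (equiv i) (and φ (dia (pre i τ) ψ))) (dia (equiv i) (and ψ (dia (pre i τ) φ)))))
  | red_seq (π π' : Program Atm Nom Agt Act) (φ : Formula Atm Nom Agt Act) :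
      DLCAAxiom (iff (box (seq π π') φ) (box π (box π' φ)))
  | red_union (π π' : Program Atm Nom Agt Act) (φ : Formula Atm Nom Agt Act) :
      DLCAAxiom (iff (box (union π π') φ) (and (box π φ) (box π' φ)))
  | add1_inter (π π' : Program Atm Nom Agt Act) (φ ψ : Formula Atm Nom Agt Act) :
      DLCAAxiom (imp (and (box π φ) (box π' ψ)) (box (inter π π') (and φ ψ)))
  | add2_inter (π π' : Program Atm Nom Agt Act) (x : Nom) :
      DLCAAxiom (imp (and (dia π (nom x)) (dia π' (nom x))) (dia (inter π π') (nom x)))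
  | conv1 (π : Program Atm Nom Agt Act) (φ : Formula Atm Nom Agt Act) :
      DLCAAxiom (imp φ (box π (dia (conv π) φ)))
  | conv2 (π : Program Atm Nom Agt Act) (φ : Formula Atm Nom Agt Act) :
      DLCAAxiom (imp φ (box (conv π) (dia π φ)))
  | comp1 (i : Agt) (τ : Kind) (φ : Formula Atm Nom Agt Act) :
      DLCAAxiom (iff (and (box (pre i τ) φ) (box (preCompl i τ) φ)) (box (equiv i) φ))
  | comp2 (i : Agt) (τ : Kind) (x : Nom) :
      DLCAAxiom (imp (dia (pre i τ) (nom x)) (box (preCompl i τ) (neg (nom x))))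
  | red_test (φ ψ : Formula Atm Nom Agt Act) :
      DLCAAxiom (iff (box (test φ) ψ) (imp φ ψ))
  | most_nom (π π' : Program Atm Nom Agt Act) (x : Nom) (φ : Formula Atm Nom Agt Act) :
      DLCAAxiom (imp (dia π (and (nom x) φ)) (box π' (imp (nom x) φ)))

/-- The three additional axioms for choices. -/
inductive ChoiceAxiom [Nonempty Atm] [Fintype Agt] [Fintype Act] :
    Formula Atm Nom Agt Act → Prop
  | mostAct (i : Agt) (a b : Act) (h : a ≠ b) :
      ChoiceAxiom (imp (play i a) (neg (play i b)))
  | leastAct (i : Agt) :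
      ChoiceAxiom (bigOr Finset.univ (fun a => play i a))
  | sic (i : Agt) (δ : Agt → Act) :
      ChoiceAxiom (imp (bigAnd Finset.univ (fun j => dia (equiv i) (play j (δ j))))
        (dia (equiv i) (playJoint δ Finset.univ)))

/-- Theorems of the logic: the least set of formulas that contains the axioms and is closed under
modus ponens, necessitation, and the infinitary rule `cov`. -/
inductive Provable [Nonempty Atm] [Fintype Agt] [Fintype Act] :
    Formula Atm Nom Agt Act → Prop
  | ax_dlca (φ : Formula Atm Nom Agt Act) (h : DLCAAxiom φ) : Provable φ
  | ax_choice (φ : Formula Atm Nom Agt Act) (h : ChoiceAxiom φ) : Provable φ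
  | mp (φ ψ : Formula Atm Nom Agt Act) (h₁ : Provable (imp φ ψ)) (h₂ : Provable φ) : Provable ψ
  | nec (π : Program Atm Nom Agt Act) (φ : Formula Atm Nom Agt Act) (h : Provable φ) :
      Provable (box π φ)
  | cov (π : Program Atm Nom Agt Act) (h : ∀ x : Nom, Provable (box π (neg (nom x)))) :
      Provable (box π bot)

end Axioms

end DLCAG

-- Soundness is an induction on derivations: (C4) makes a nominal true at most at one world, which
-- validates the axioms mentioning nominals, and (C3) gives every world a name, which validates
-- (Cov).
--
-- Completeness builds a canonical model in which every world is named. Let `¬φ` be consistent. A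
-- Lindenbaum construction (`exists_isNamed`) extends it to a maximal consistent `Γ` such that `[π]⊥
-- ∉ Γ` always comes with a nominal `x` satisfying `⟨π⟩x ∈ Γ`; (Cov) is what allows such an `x` to
-- be chosen. The worlds are the sets `{ψ | [π](x → ψ) ∈ Γ}` with `⟨π⟩x ∈ Γ`. Axiom 11 makes such a
-- set depend on `x` only and not on `π`, so equally named worlds coincide.
--
-- Names also control accessibility: a world named `y` is a `π`-successor of `Δ` as soon as `⟨π⟩y ∈
-- Δ` (`CanRel.of_nom`). Hence the canonical relations of intersections, converses and complements
-- are exactly the intended ones, and no unravelling or copying of worlds is needed. With the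
-- existence lemma `IsWorld.exists_canRel` the truth lemma follows by induction, and (C5) is read
-- off (SIC).

namespace DLCAG

open Formula Program

variable {Atm : Type u₁} {Nom : Type u₂} {Agt : Type u₃} {Act : Type u₄}

-- Soundness

section Soundness

variable (M : MCMC.{u₁, u₂, u₃, u₄, v} Atm Nom Agt Act) (w : M.W)

theorem sat_neg (φ : Formula Atm Nom Agt Act) : Sat M (neg φ) w ↔ ¬ Sat M φ w := by
  simp only [Sat]

theorem sat_and (φ ψ : Formula Atm Nom Agt Act) :
    Sat M (and φ ψ) w ↔ Sat M φ w ∧ Sat M ψ w := by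
  simp only [Sat]

theorem sat_imp (φ ψ : Formula Atm Nom Agt Act) :
    Sat M (imp φ ψ) w ↔ (Sat M φ w → Sat M ψ w) := by
  simp only [imp, Sat]; tauto

theorem sat_or (φ ψ : Formula Atm Nom Agt Act) :
    Sat M (Formula.or φ ψ) w ↔ (Sat M φ w ∨ Sat M ψ w) := by
  simp only [Formula.or, Sat]; tauto

theorem sat_iff (φ ψ : Formula Atm Nom Agt Act) :
    Sat M (Formula.iff φ ψ) w ↔ (Sat M φ w ↔ Sat M ψ w) := by
  simp only [Formula.iff, sat_and, sat_imp]; tauto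

theorem sat_box (π : Program Atm Nom Agt Act) (φ : Formula Atm Nom Agt Act) :
    Sat M (box π φ) w ↔ ∀ v, Rel M π w v → Sat M φ v := by
  simp only [Sat]

theorem sat_dia (π : Program Atm Nom Agt Act) (φ : Formula Atm Nom Agt Act) :
    Sat M (dia π φ) w ↔ ∃ v, Rel M π w v ∧ Sat M φ v := by
  simp only [dia, Sat]; push Not; rfl

theorem sat_bot [Nonempty Atm] : ¬ Sat M bot w := by
  simp only [bot, Sat]; tauto

theorem sat_top [Nonempty Atm] : Sat M top w := by
  rw [top, sat_neg]; exact sat_bot M w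

theorem sat_bigAnd [Nonempty Atm] {κ : Type*} (s : Finset κ)
    (f : κ → Formula Atm Nom Agt Act) : Sat M (bigAnd s f) w ↔ ∀ k ∈ s, Sat M (f k) w := by
  have key : ∀ l : List κ, Sat M ((l.map f).foldr and top) w ↔ ∀ k ∈ l, Sat M (f k) w := by
    intro l
    induction l with
    | nil => simp [sat_top]
    | cons k l ih => simp [sat_and, ih]
  simp [bigAnd, key]

theorem sat_bigOr [Nonempty Atm] {κ : Type*} (s : Finset κ)
    (f : κ → Formula Atm Nom Agt Act) : Sat M (bigOr s f) w ↔ ∃ k ∈ s, Sat M (f k) w := by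
  have key : ∀ l : List κ, Sat M ((l.map f).foldr Formula.or bot) w ↔ ∃ k ∈ l, Sat M (f k) w := by
    intro l
    induction l with
    | nil => simp [sat_bot]
    | cons k l ih => simp [sat_or, ih]
  simp [bigOr, key]

theorem eq_of_sat_nom {M : MCMC.{u₁, u₂, u₃, u₄, v} Atm Nom Agt Act} {w w' : M.W} {x : Nom}
    (h : Sat M (nom x) w) (h' : Sat M (nom x) w') : w = w' := by
  simp only [Sat] at h h'
  exact M.c4 w w' ⟨x, h, h'⟩

/-- Only the axioms on nominals (`add2_inter`, `comp2`, `most_nom`) need (C4): two successors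
carrying the same nominal are the same world. The others are immediate from the frame conditions and
the clauses for programs. -/
theorem DLCAAxiom.valid {φ : Formula Atm Nom Agt Act} (h : DLCAAxiom φ) :
    Valid.{u₁, u₂, u₃, u₄, v} φ := by
  intro M w
  cases h with
  | taut φ h => exact h (fun ψ => Sat M ψ w) (sat_neg M w) (sat_and M w)
  | k π φ ψ =>
    simp only [sat_imp, sat_and, sat_box]
    exact fun h v hv => h.2 v hv (h.1 v hv)
  | t_equiv i φ =>
    simp only [sat_imp, sat_box, Rel]
    exact fun h => h w ((M.equiv_equivalence i).refl w)
  | four_equiv i φ =>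
    simp only [sat_imp, sat_box, Rel]
    exact fun h v hv u hu => h u ((M.equiv_equivalence i).trans hv hu)
  | five_equiv i φ =>
    simp only [sat_imp, sat_neg, sat_box, Rel]
    exact fun h v hv h' => h fun u hu =>
      h' u ((M.equiv_equivalence i).trans ((M.equiv_equivalence i).symm hv) hu)
  | t_pre i τ φ =>
    simp only [sat_imp, sat_box, Rel]
    exact fun h => h w (M.pre_refl i τ w)
  | four_pre i τ φ =>
    simp only [sat_imp, sat_box, Rel]
    exact fun h v hv u hu => h u (M.pre_trans i τ _ _ _ hv hu)
  | inc i τ φ =>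
    simp only [sat_imp, sat_box, Rel]
    exact fun h v hv => h v (M.c1 i τ _ _ hv)
  | conn i τ φ ψ =>
    simp only [sat_imp, sat_and, sat_or, sat_dia, Rel]
    rintro ⟨⟨v, hv, hφ⟩, u, hu, hψ⟩
    have huv := (M.equiv_equivalence i).trans ((M.equiv_equivalence i).symm hv) hu
    rcases M.c2 i τ v u huv with h | h
    · exact Or.inl ⟨v, hv, hφ, u, h, hψ⟩
    · exact Or.inr ⟨u, hu, hψ, v, h, hφ⟩
  | red_seq π π' φ =>
    simp only [sat_iff, sat_box, Rel]
    exact ⟨fun h v hv u hu => h u ⟨v, hv, hu⟩, fun h u ⟨v, hv, hu⟩ => h v hv u hu⟩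
  | red_union π π' φ =>
    simp only [sat_iff, sat_and, sat_box, Rel]
    exact ⟨fun h => ⟨fun v hv => h v (.inl hv), fun v hv => h v (.inr hv)⟩,
      fun h v hv => hv.elim (h.1 v) (h.2 v)⟩
  | add1_inter π π' φ ψ =>
    simp only [sat_imp, sat_and, sat_box, Rel]
    exact fun h v hv => ⟨h.1 v hv.1, h.2 v hv.2⟩
  | add2_inter π π' x =>
    simp only [sat_imp, sat_and, sat_dia, Rel]
    rintro ⟨⟨v, hv, hx⟩, u, hu, hx'⟩
    obtain rfl := eq_of_sat_nom hx hx'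
    exact ⟨v, ⟨hv, hu⟩, hx⟩
  | conv1 π φ =>
    simp only [sat_imp, sat_box, sat_dia, Rel]
    exact fun h v hv => ⟨w, hv, h⟩
  | conv2 π φ =>
    simp only [sat_imp, sat_box, sat_dia, Rel]
    exact fun h v hv => ⟨w, hv, h⟩
  | comp1 i τ φ =>
    simp only [sat_iff, sat_and, sat_box, Rel]
    refine ⟨fun h v hv => ?_, fun h => ⟨fun v hv => h v (M.c1 i τ _ _ hv), fun v hv => h v hv.1⟩⟩
    by_cases hp : M.pre i τ w v
    · exact h.1 v hp
    · exact h.2 v ⟨hv, hp⟩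
  | comp2 i τ x =>
    simp only [sat_imp, sat_neg, sat_dia, sat_box, Rel]
    rintro ⟨v, hv, hx⟩ u hu hx'
    obtain rfl := eq_of_sat_nom hx hx'
    exact hu.2 hv
  | red_test φ ψ =>
    simp only [sat_iff, sat_imp, sat_box, Rel]
    exact ⟨fun h hφ => h w ⟨rfl, hφ⟩, fun h v hv => hv.1 ▸ h hv.2⟩
  | most_nom π π' x φ =>
    simp only [sat_imp, sat_and, sat_dia, sat_box]
    rintro ⟨v, hv, hx, hφ⟩ u hu hx'
    obtain rfl := eq_of_sat_nom hx hx'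
    exact hφ

theorem ChoiceAxiom.valid [Nonempty Atm] [Fintype Agt] [Fintype Act]
    {φ : Formula Atm Nom Agt Act} (h : ChoiceAxiom φ) : Valid.{u₁, u₂, u₃, u₄, v} φ := by
  intro M w
  cases h with
  | mostAct i a b h =>
    simp only [sat_imp, Sat]
    rintro rfl
    exact h
  | leastAct i =>
    rw [sat_bigOr]
    exact ⟨M.C i w, Finset.mem_univ _, by simp only [Sat]⟩
  | sic i δ =>
    simp only [sat_imp, sat_dia, playJoint, sat_bigAnd, Finset.mem_univ, true_imp_iff]
    simp only [Rel, Sat]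
    exact M.c5 i δ w

theorem Provable.valid [Nonempty Atm] [Fintype Agt] [Fintype Act]
    {φ : Formula Atm Nom Agt Act} (h : Provable φ) : Valid.{u₁, u₂, u₃, u₄, v} φ := by
  induction h with
  | ax_dlca φ h => exact h.valid
  | ax_choice φ h => exact h.valid
  | mp φ ψ _ _ h₁ h₂ => exact fun M w => (sat_imp M w φ ψ).1 (h₁ M w) (h₂ M w)
  | nec π φ _ h => exact fun M w => (sat_box M w π φ).2 fun v _ => h M v
  | cov π _ h =>
    refine fun M w => (sat_box M w π _).2 fun v hv => ?_
    -- A successor of `w` would have a name `x` by (C3), against the premise for that `x`.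
    obtain ⟨x, hx⟩ := M.c3 v
    exact absurd (by simp only [Sat]; exact hx)
      ((sat_neg M v _).1 ((sat_box M w π _).1 (h x M w) v hv))

end Soundness

-- Gödel numbering of programs and formulas

section Countability

variable [Encodable Atm] [Encodable Nom] [Encodable Agt] [Encodable Act]

/-- A numerical code for the two kinds. -/
def Kind.code : Kind → ℕ
  | .P => 0
  | .D => 1

theorem Kind.code_injective : Function.Injective Kind.code := by
  intro a b h
  cases a <;> cases b <;> simp_all [Kind.code]

mutual
  /-- Gödel number of a program. -/
  def Program.code : Program Atm Nom Agt Act → ℕ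
    | .equiv i => Nat.pair 0 (Encodable.encode i)
    | .pre i τ => Nat.pair 1 (Nat.pair (Encodable.encode i) τ.code)
    | .preCompl i τ => Nat.pair 2 (Nat.pair (Encodable.encode i) τ.code)
    | .seq π π' => Nat.pair 3 (Nat.pair π.code π'.code)
    | .union π π' => Nat.pair 4 (Nat.pair π.code π'.code)
    | .inter π π' => Nat.pair 5 (Nat.pair π.code π'.code)
    | .conv π => Nat.pair 6 π.code
    | .test φ => Nat.pair 7 φ.code

  /-- Gödel number of a formula. -/
  def Formula.code : Formula Atm Nom Agt Act → ℕ
    | .atom p => Nat.pair 0 (Encodable.encode p)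
    | .nom x => Nat.pair 1 (Encodable.encode x)
    | .play i a => Nat.pair 2 (Nat.pair (Encodable.encode i) (Encodable.encode a))
    | .neg φ => Nat.pair 3 φ.code
    | .and φ ψ => Nat.pair 4 (Nat.pair φ.code ψ.code)
    | .box π φ => Nat.pair 5 (Nat.pair π.code φ.code)
end

mutual
  theorem Program.eq_of_code_eq : ∀ π π' : Program Atm Nom Agt Act, π.code = π'.code → π = π'
    | .equiv i, π' => by
      cases π' <;> simp [Program.code, Nat.pair_eq_pair]
    | .pre i τ, π' => by
      cases π' <;> simp +contextual [Program.code, Nat.pair_eq_pair, Kind.code_injective.eq_iff]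
    | .preCompl i τ, π' => by
      cases π' <;> simp +contextual [Program.code, Nat.pair_eq_pair, Kind.code_injective.eq_iff]
    | .seq π₁ π₂, π' => by
      have h₁ := Program.eq_of_code_eq π₁
      have h₂ := Program.eq_of_code_eq π₂
      cases π' <;> simp [Program.code, Nat.pair_eq_pair]
      exact fun h h' => ⟨h₁ _ h, h₂ _ h'⟩
    | .union π₁ π₂, π' => by
      have h₁ := Program.eq_of_code_eq π₁
      have h₂ := Program.eq_of_code_eq π₂
      cases π' <;> simp [Program.code, Nat.pair_eq_pair]
      exact fun h h' => ⟨h₁ _ h, h₂ _ h'⟩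
    | .inter π₁ π₂, π' => by
      have h₁ := Program.eq_of_code_eq π₁
      have h₂ := Program.eq_of_code_eq π₂
      cases π' <;> simp [Program.code, Nat.pair_eq_pair]
      exact fun h h' => ⟨h₁ _ h, h₂ _ h'⟩
    | .conv π, π' => by
      have h₁ := Program.eq_of_code_eq π
      cases π' <;> simp [Program.code, Nat.pair_eq_pair]
      exact h₁ _
    | .test φ, π' => by
      have h₁ := Formula.eq_of_code_eq φ
      cases π' <;> simp [Program.code, Nat.pair_eq_pair]
      exact h₁ _

  theorem Formula.eq_of_code_eq : ∀ φ φ' : Formula Atm Nom Agt Act, φ.code = φ'.code → φ = φ'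
    | .atom p, φ' => by
      cases φ' <;> simp [Formula.code, Nat.pair_eq_pair]
    | .nom x, φ' => by
      cases φ' <;> simp [Formula.code, Nat.pair_eq_pair]
    | .play i a, φ' => by
      cases φ' <;> simp +contextual [Formula.code, Nat.pair_eq_pair]
    | .neg φ, φ' => by
      have h₁ := Formula.eq_of_code_eq φ
      cases φ' <;> simp [Formula.code, Nat.pair_eq_pair]
      exact h₁ _
    | .and φ ψ, φ' => by
      have h₁ := Formula.eq_of_code_eq φ
      have h₂ := Formula.eq_of_code_eq ψ
      cases φ' <;> simp [Formula.code, Nat.pair_eq_pair]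
      exact fun h h' => ⟨h₁ _ h, h₂ _ h'⟩
    | .box π φ, φ' => by
      have h₁ := Program.eq_of_code_eq π
      have h₂ := Formula.eq_of_code_eq φ
      cases φ' <;> simp [Formula.code, Nat.pair_eq_pair]
      exact fun h h' => ⟨h₁ _ h, h₂ _ h'⟩
end

end Countability

/-- Used twice: to enumerate formulas in the Lindenbaum construction, and to bound the number of
canonical worlds. -/
instance Formula.instCountable [Countable Atm] [Countable Nom] [Countable Agt] [Countable Act] :
    Countable (Formula Atm Nom Agt Act) := by
  have := Encodable.ofCountable Atm
  have := Encodable.ofCountable Nom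
  have := Encodable.ofCountable Agt
  have := Encodable.ofCountable Act
  exact Function.Injective.countable (f := Formula.code) fun φ ψ h => Formula.eq_of_code_eq φ ψ h

/-- The formulas true in the state named `x` reached from `Γ` by `π`. -/
def stateAt (Γ : Set (Formula Atm Nom Agt Act)) (π : Program Atm Nom Agt Act) (x : Nom) :
    Set (Formula Atm Nom Agt Act) :=
  {φ | box π (imp (nom x) φ) ∈ Γ}

theorem mem_stateAt {Γ : Set (Formula Atm Nom Agt Act)} {π : Program Atm Nom Agt Act} {x : Nom}
    {φ : Formula Atm Nom Agt Act} : φ ∈ stateAt Γ π x ↔ box π (imp (nom x) φ) ∈ Γ := Iff.rfl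

-- Derived rules and maximal consistent sets

variable [Nonempty Atm] [Fintype Agt] [Fintype Act]

theorem Provable.of_taut {φ : Formula Atm Nom Agt Act} (h : φ.IsTautology) : Provable φ :=
  .ax_dlca _ (.taut _ h)

theorem Provable.taut_mp {φ ψ : Formula Atm Nom Agt Act} (h : Provable φ)
    (ht : (imp φ ψ).IsTautology) : Provable ψ :=
  .mp _ _ (.of_taut ht) h

theorem Provable.taut_mp₂ {φ ψ χ : Formula Atm Nom Agt Act} (h : Provable φ) (h' : Provable ψ)
    (ht : (imp φ (imp ψ χ)).IsTautology) : Provable χ :=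
  .mp _ _ (h.taut_mp ht) h'

theorem Provable.box_mono {φ ψ : Formula Atm Nom Agt Act} (π : Program Atm Nom Agt Act)
    (h : Provable (imp φ ψ)) : Provable (imp (box π φ) (box π ψ)) :=
  (h.nec π).taut_mp₂ (.ax_dlca _ (.k π φ ψ)) (by
    intro val hn ha; simp only [imp, hn, ha]; tauto)

/-- A formula is consistent if its negation is not provable. -/
def Consistent (φ : Formula Atm Nom Agt Act) : Prop := ¬ Provable (neg φ)

theorem Provable.imp_trans {φ ψ χ : Formula Atm Nom Agt Act} (h : Provable (imp φ ψ))
    (h' : Provable (imp ψ χ)) : Provable (imp φ χ) :=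
  h.taut_mp₂ h' (by intro val hn ha; simp only [imp, hn, ha]; tauto)

/-- The rule `cov` relativized to a hypothesis. -/
theorem Provable.cov_of_imp {ψ : Formula Atm Nom Agt Act} {π : Program Atm Nom Agt Act}
    (h : ∀ x, Provable (imp ψ (box π (neg (nom x))))) : Provable (imp ψ (box π bot)) := by
  -- The hypothesis is absorbed into the program: (Cov) is applied to `ψ?;π`, whose box is `ψ →
  -- [π]·`.
  have key : ∀ χ, Provable (Formula.iff (box (seq (test ψ) π) χ) (imp ψ (box π χ))) := fun χ =>
    (Provable.ax_dlca _ (.red_seq (test ψ) π χ)).taut_mp₂ (.ax_dlca _ (.red_test ψ (box π χ))) (by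
      intro val hn ha; simp only [imp, Formula.iff, hn, ha]; tauto)
  have h' := Provable.cov (seq (test ψ) π) fun x => (key _).taut_mp₂ (h x) (by
    intro val hn ha; simp only [imp, Formula.iff, hn, ha]; tauto)
  exact (key _).taut_mp₂ h' (by
    intro val hn ha; simp only [imp, Formula.iff, hn, ha]; tauto)

/-- A maximal consistent set of formulas. -/
structure IsMCS (Γ : Set (Formula Atm Nom Agt Act)) : Prop where
  mem_of_provable : ∀ {φ}, Provable φ → φ ∈ Γ
  neg_mem : ∀ φ, neg φ ∈ Γ ↔ φ ∉ Γ
  and_mem : ∀ φ ψ, Formula.and φ ψ ∈ Γ ↔ φ ∈ Γ ∧ ψ ∈ Γ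

/-- A maximal consistent set in which every possible program execution ends in a named state. -/
structure IsNamed (Γ : Set (Formula Atm Nom Agt Act)) : Prop extends IsMCS Γ where
  exists_nom : ∀ π, box π bot ∉ Γ → ∃ x, box π (neg (nom x)) ∉ Γ

-- Lindenbaum construction with named witnesses

section Lindenbaum

/-- One stage of the construction: decide `χ`, and when `[π]⊥` is rejected, also commit to a name
for some `π`-successor. If every nominal were refuted, the relativized (Cov) would derive `[π]⊥`. No
fresh nominal is required. -/
theorem Consistent.exists_step {ψ : Formula Atm Nom Agt Act} (hψ : Consistent ψ)
    (χ : Formula Atm Nom Agt Act) :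
    ∃ ψ', Consistent ψ' ∧ Provable (imp ψ' ψ) ∧
      (Provable (imp ψ' χ) ∨ (Provable (imp ψ' (neg χ)) ∧
        ∀ π, χ = box π bot → ∃ x, Provable (imp ψ' (neg (box π (neg (nom x))))))) := by
  by_cases h : Provable (imp ψ χ)
  · exact ⟨ψ, hψ, .of_taut (by intro val hn ha; simp only [imp, hn, ha]; tauto), .inl h⟩
  by_cases hπ : ∃ π, χ = box π bot
  · obtain ⟨π, rfl⟩ := hπ
    obtain ⟨x, hx⟩ : ∃ x, ¬ Provable (imp (and ψ (neg (box π bot))) (box π (neg (nom x)))) := by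
      by_contra! hall
      exact h ((Provable.cov_of_imp hall).taut_mp (by
        intro val hn ha; simp only [imp, hn, ha]; tauto))
    -- `imp A B` unfolds to `neg (and A (neg B))`, so the unprovability `hx` is literally the
    -- consistency of this conjunction.
    refine ⟨and (and ψ (neg (box π bot))) (neg (box π (neg (nom x)))), hx,
      .of_taut (by intro val hn ha; simp only [imp, hn, ha]; tauto), .inr
      ⟨.of_taut (by intro val hn ha; simp only [imp, hn, ha]; tauto), ?_⟩⟩
    intro π' h'
    cases h'
    exact ⟨x, .of_taut (by intro val hn ha; simp only [imp, hn, ha]; tauto)⟩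
  · exact ⟨and ψ (neg χ), h, .of_taut (by intro val hn ha; simp only [imp, hn, ha]; tauto), .inr
      ⟨.of_taut (by intro val hn ha; simp only [imp, hn, ha]; tauto), fun π h' =>
        (hπ ⟨π, h'⟩).elim⟩⟩

theorem exists_isNamed [Countable Atm] [Countable Nom] {φ : Formula Atm Nom Agt Act}
    (hφ : Consistent φ) : ∃ Γ, IsNamed Γ ∧ φ ∈ Γ := by
  have : Nonempty (Formula Atm Nom Agt Act) := ⟨φ⟩
  obtain ⟨f, hf⟩ := exists_surjective_nat (Formula Atm Nom Agt Act)
  choose step hcons hle hdec using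
    fun (ψ : {ψ : Formula Atm Nom Agt Act // Consistent ψ}) => ψ.2.exists_step
  let s : ℕ → {ψ : Formula Atm Nom Agt Act // Consistent ψ} := fun n =>
    Nat.rec ⟨φ, hφ⟩ (fun n ψ => ⟨step ψ (f n), hcons ψ (f n)⟩) n
  have hs : ∀ n, s (n + 1) = ⟨step (s n) (f n), hcons (s n) (f n)⟩ := fun n => rfl
  have hmono : ∀ m n, m ≤ n → Provable (imp (s n).1 (s m).1) := by
    intro m n hmn
    induction n, hmn using Nat.le_induction with
    | base => exact .of_taut (by intro val hn ha; simp only [imp, hn, ha]; tauto)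
    | succ n _ ih => rw [hs]; exact (hle (s n) (f n)).imp_trans ih
  -- Each stage is a single formula implying its predecessors; `Γ` collects whatever some stage
  -- implies.
  let Γ : Set (Formula Atm Nom Agt Act) := {χ | ∃ n, Provable (imp (s n).1 χ)}
  have hup : ∀ {χ m n}, m ≤ n → Provable (imp (s m).1 χ) → Provable (imp (s n).1 χ) :=
    fun hmn h => (hmono _ _ hmn).imp_trans h
  have hmp : ∀ {χ χ'}, χ ∈ Γ → Provable (imp χ χ') → χ' ∈ Γ :=
    fun ⟨n, h⟩ h' => ⟨n, h.imp_trans h'⟩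
  have hand : ∀ {χ χ'}, χ ∈ Γ → χ' ∈ Γ → and χ χ' ∈ Γ := fun ⟨m, h⟩ ⟨n, h'⟩ =>
    ⟨max m n, (hup (le_max_left m n) h).taut_mp₂ (hup (le_max_right m n) h') (by
      intro val hn ha; simp only [imp, hn, ha]; tauto)⟩
  have hno : ∀ {χ}, χ ∈ Γ → neg χ ∉ Γ := fun h h' => by
    obtain ⟨n, hn⟩ := hand h h'
    exact (s n).2 (hn.taut_mp (by intro val hn ha; simp only [imp, hn, ha]; tauto))
  have hdec' : ∀ χ, χ ∈ Γ ∨ (neg χ ∈ Γ ∧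
      ∀ π, χ = box π bot → ∃ x, neg (box π (neg (nom x))) ∈ Γ) := by
    intro χ
    obtain ⟨n, rfl⟩ := hf χ
    rcases hdec (s n) (f n) with h | ⟨h, h'⟩
    · exact .inl ⟨n + 1, h⟩
    · exact .inr ⟨⟨n + 1, h⟩, fun π hπ => (h' π hπ).imp fun x hx => ⟨n + 1, hx⟩⟩
  refine ⟨Γ, ⟨⟨fun h => ⟨0, h.taut_mp ?_⟩, fun χ => ⟨fun h h' => hno h' h, fun h => ?_⟩,
    fun χ χ' => ⟨fun h => ⟨hmp h (.of_taut ?_), hmp h (.of_taut ?_)⟩, fun h => hand h.1 h.2⟩⟩,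
    fun π h => ?_⟩, 0, .of_taut ?_⟩
  · intro val hn ha; simp only [imp, hn, ha]; tauto
  · exact ((hdec' χ).resolve_left h).1
  · intro val hn ha; simp only [imp, hn, ha]; tauto
  · intro val hn ha; simp only [imp, hn, ha]; tauto
  · obtain ⟨x, hx⟩ := ((hdec' _).resolve_left h).2 π rfl
    exact ⟨x, fun h' => hno h' hx⟩
  · intro val hn ha; simp only [imp, hn, ha]; tauto

end Lindenbaum

-- Boolean and modal closure of maximal consistent sets

namespace IsMCS

variable {Γ : Set (Formula Atm Nom Agt Act)}

theorem mem_imp (hΓ : IsMCS Γ) (φ ψ : Formula Atm Nom Agt Act) :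
    imp φ ψ ∈ Γ ↔ (φ ∈ Γ → ψ ∈ Γ) := by
  simp only [imp, hΓ.neg_mem, hΓ.and_mem]; tauto

theorem mem_or (hΓ : IsMCS Γ) (φ ψ : Formula Atm Nom Agt Act) :
    Formula.or φ ψ ∈ Γ ↔ (φ ∈ Γ ∨ ψ ∈ Γ) := by
  simp only [Formula.or, hΓ.neg_mem, hΓ.and_mem]; tauto

theorem mem_iff (hΓ : IsMCS Γ) (φ ψ : Formula Atm Nom Agt Act) :
    Formula.iff φ ψ ∈ Γ ↔ (φ ∈ Γ ↔ ψ ∈ Γ) := by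
  simp only [Formula.iff, hΓ.mem_imp, hΓ.and_mem]; tauto

theorem mem_dia (hΓ : IsMCS Γ) (π : Program Atm Nom Agt Act) (φ : Formula Atm Nom Agt Act) :
    dia π φ ∈ Γ ↔ box π (neg φ) ∉ Γ := by
  simp only [dia, hΓ.neg_mem]

theorem bot_notMem (hΓ : IsMCS Γ) : bot ∉ Γ := by
  simp only [bot, hΓ.neg_mem, hΓ.and_mem]; tauto

theorem top_mem (hΓ : IsMCS Γ) : top ∈ Γ := by
  rw [top, hΓ.neg_mem]; exact hΓ.bot_notMem

theorem mem_bigAnd (hΓ : IsMCS Γ) {κ : Type*} (s : Finset κ)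
    (f : κ → Formula Atm Nom Agt Act) : bigAnd s f ∈ Γ ↔ ∀ k ∈ s, f k ∈ Γ := by
  have key : ∀ l : List κ, (l.map f).foldr Formula.and top ∈ Γ ↔ ∀ k ∈ l, f k ∈ Γ := by
    intro l
    induction l with
    | nil => simp [hΓ.top_mem]
    | cons k l ih => simp [hΓ.and_mem, ih]
  simp [bigAnd, key]

theorem mem_bigOr (hΓ : IsMCS Γ) {κ : Type*} (s : Finset κ)
    (f : κ → Formula Atm Nom Agt Act) : bigOr s f ∈ Γ ↔ ∃ k ∈ s, f k ∈ Γ := by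
  have key : ∀ l : List κ, (l.map f).foldr Formula.or bot ∈ Γ ↔ ∃ k ∈ l, f k ∈ Γ := by
    intro l
    induction l with
    | nil => simp [hΓ.bot_notMem]
    | cons k l ih => simp [hΓ.mem_or, ih]
  simp [bigOr, key]

theorem mem_of_axiom (hΓ : IsMCS Γ) {φ : Formula Atm Nom Agt Act} (h : DLCAAxiom φ) : φ ∈ Γ :=
  hΓ.mem_of_provable (.ax_dlca _ h)

theorem box_mono (hΓ : IsMCS Γ) {π : Program Atm Nom Agt Act} {φ ψ : Formula Atm Nom Agt Act}
    (h : box π φ ∈ Γ) (hp : Provable (imp φ ψ)) : box π ψ ∈ Γ :=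
  (hΓ.mem_imp _ _).1 (hΓ.mem_of_provable (hp.box_mono π)) h

theorem box_mono₂ (hΓ : IsMCS Γ) {π : Program Atm Nom Agt Act} {φ ψ χ : Formula Atm Nom Agt Act}
    (h : box π φ ∈ Γ) (h' : box π ψ ∈ Γ) (ht : (imp φ (imp ψ χ)).IsTautology) : box π χ ∈ Γ :=
  (hΓ.mem_imp _ _).1 (hΓ.mem_of_axiom (.k π ψ χ))
    ((hΓ.and_mem _ _).2 ⟨h', hΓ.box_mono h (.of_taut ht)⟩)

theorem box_iff (hΓ : IsMCS Γ) {π : Program Atm Nom Agt Act} {φ ψ : Formula Atm Nom Agt Act}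
    (h : Provable (Formula.iff φ ψ)) : box π φ ∈ Γ ↔ box π ψ ∈ Γ :=
  ⟨fun h' => hΓ.box_mono h' (h.taut_mp (by
      intro val hn ha; simp only [imp, Formula.iff, hn, ha]; tauto)),
    fun h' => hΓ.box_mono h' (h.taut_mp (by
      intro val hn ha; simp only [imp, Formula.iff, hn, ha]; tauto))⟩

theorem box_seq (hΓ : IsMCS Γ) (π π' : Program Atm Nom Agt Act) (φ : Formula Atm Nom Agt Act) :
    box (seq π π') φ ∈ Γ ↔ box π (box π' φ) ∈ Γ :=
  (hΓ.mem_iff _ _).1 (hΓ.mem_of_axiom (.red_seq π π' φ))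

theorem box_seq_test (hΓ : IsMCS Γ) (π : Program Atm Nom Agt Act)
    (φ ψ : Formula Atm Nom Agt Act) :
    box (seq π (test φ)) ψ ∈ Γ ↔ box π (imp φ ψ) ∈ Γ :=
  (hΓ.box_seq _ _ _).trans (hΓ.box_iff (.ax_dlca _ (.red_test φ ψ)))

theorem box_seq_test_seq (hΓ : IsMCS Γ) (π π' : Program Atm Nom Agt Act)
    (φ ψ : Formula Atm Nom Agt Act) :
    box (seq (seq π (test φ)) π') ψ ∈ Γ ↔ box π (imp φ (box π' ψ)) ∈ Γ :=
  (hΓ.box_seq _ _ _).trans (hΓ.box_seq_test _ _ _)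

theorem box_imp_nom (hΓ : IsMCS Γ) {π : Program Atm Nom Agt Act} {x : Nom}
    {φ : Formula Atm Nom Agt Act} (h : box π (neg (and (nom x) φ)) ∉ Γ)
    (π' : Program Atm Nom Agt Act) : box π' (imp (nom x) φ) ∈ Γ :=
  (hΓ.mem_imp _ _).1 (hΓ.mem_of_axiom (.most_nom π π' x φ)) ((hΓ.mem_dia _ _).2 h)

/-- Together `⟨π⟩x` and `[π](x → φ)` give `⟨π⟩(x ∧ φ)`, which axiom 11 carries to any other program.
This makes a named state independent of the program that reaches it. -/
theorem box_imp_nom_of_box (hΓ : IsMCS Γ) {π : Program Atm Nom Agt Act} {x : Nom}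
    {φ : Formula Atm Nom Agt Act} (hx : box π (neg (nom x)) ∉ Γ)
    (h : box π (imp (nom x) φ) ∈ Γ) (π' : Program Atm Nom Agt Act) :
    box π' (imp (nom x) φ) ∈ Γ :=
  hΓ.box_imp_nom (fun h' => hx (hΓ.box_mono₂ h h' (by
    intro val hn ha; simp only [imp, hn, ha]; tauto))) π'

end IsMCS

/-- The worlds of the canonical model generated by `Γ`. -/
def IsWorld (Γ Δ : Set (Formula Atm Nom Agt Act)) : Prop :=
  ∃ π x, box π (neg (nom x)) ∉ Γ ∧ Δ = stateAt Γ π x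

/-- The canonical relation of a program. -/
def CanRel (π : Program Atm Nom Agt Act) (Δ Δ' : Set (Formula Atm Nom Agt Act)) : Prop :=
  ∀ φ, box π φ ∈ Δ → φ ∈ Δ'

-- Named worlds and the existence lemma

section Worlds

variable {Γ Δ Δ' : Set (Formula Atm Nom Agt Act)}

theorem IsMCS.nom_mem_stateAt (hΓ : IsMCS Γ) (π : Program Atm Nom Agt Act) (x : Nom) :
    nom x ∈ stateAt Γ π x :=
  hΓ.mem_of_provable (.nec _ _ (.of_taut (by
    intro val hn ha; simp only [imp, hn, ha]; tauto)))

/-- Consistency comes from `⟨π⟩x ∈ Γ`, maximality from axiom 11 (with `x → φ` unfolded as `¬(x ∧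
¬φ)`). Witnessing names for `π'` at the state `x` are those of `π;x?;π'` at `Γ`. -/
theorem IsWorld.isNamed (hΓ : IsNamed Γ) (hΔ : IsWorld Γ Δ) : IsNamed Δ := by
  obtain ⟨π, x, hx, rfl⟩ := hΔ
  refine ⟨⟨fun h => hΓ.mem_of_provable (.nec _ _ (h.taut_mp ?_)), fun φ => ⟨fun h h' => hx ?_,
    fun h => hΓ.box_imp_nom h π⟩, fun φ ψ => ⟨fun h => ⟨hΓ.box_mono h (.of_taut ?_),
    hΓ.box_mono h (.of_taut ?_)⟩, fun h => hΓ.box_mono₂ h.1 h.2 ?_⟩⟩, fun π' h => ?_⟩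
  · intro val hn ha; simp only [imp, hn, ha]; tauto
  · exact hΓ.box_mono₂ h h' (by intro val hn ha; simp only [imp, hn, ha]; tauto)
  · intro val hn ha; simp only [imp, hn, ha]; tauto
  · intro val hn ha; simp only [imp, hn, ha]; tauto
  · intro val hn ha; simp only [imp, hn, ha]; tauto
  · rw [mem_stateAt, ← hΓ.box_seq_test_seq] at h
    obtain ⟨y, hy⟩ := hΓ.exists_nom _ h
    exact ⟨y, by rwa [mem_stateAt, ← hΓ.box_seq_test_seq]⟩

theorem IsWorld.exists_nom (hΓ : IsNamed Γ) (hΔ : IsWorld Γ Δ) : ∃ x, nom x ∈ Δ := by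
  obtain ⟨π, x, hx, rfl⟩ := hΔ
  exact ⟨x, hΓ.nom_mem_stateAt π x⟩

theorem IsWorld.eq_stateAt (hΓ : IsNamed Γ) (hΔ : IsWorld Γ Δ) {y : Nom} (hy : nom y ∈ Δ) :
    ∃ π, box π (neg (nom y)) ∉ Γ ∧ Δ = stateAt Γ π y := by
  obtain ⟨π, x, hx, rfl⟩ := hΔ
  rw [mem_stateAt] at hy
  refine ⟨π, fun h => hx (hΓ.box_mono₂ hy h ?_), Set.ext fun φ => ⟨fun h => ?_, fun h => ?_⟩⟩
  · intro val hn ha; simp only [imp, hn, ha]; tauto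
  · refine hΓ.box_imp_nom (π := π) (fun h' => hx ?_) π
    refine hΓ.box_mono₂ (hΓ.box_mono₂ hy h (χ := imp (nom x) (and (nom y) φ)) ?_) h' ?_
    · intro val hn ha; simp only [imp, hn, ha]; tauto
    · intro val hn ha; simp only [imp, hn, ha]; tauto
  · exact hΓ.box_mono₂ hy h (by intro val hn ha; simp only [imp, hn, ha]; tauto)

theorem IsWorld.eq_of_nom (hΓ : IsNamed Γ) (hΔ : IsWorld Γ Δ) (hΔ' : IsWorld Γ Δ') {y : Nom}
    (hy : nom y ∈ Δ) (hy' : nom y ∈ Δ') : Δ = Δ' := by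
  obtain ⟨π, h, rfl⟩ := hΔ.eq_stateAt hΓ hy
  obtain ⟨π', h', rfl⟩ := hΔ'.eq_stateAt hΓ hy'
  exact Set.ext fun φ => ⟨fun hφ => hΓ.box_imp_nom_of_box h hφ π',
    fun hφ => hΓ.box_imp_nom_of_box h' hφ π⟩

/-- Seen from `Γ`, the program `π₀;x?;π` reaches `y` and forces `φ` wherever it ends, so the state
named `y` contains `φ`. With `CanRel.box_neg_nom`, accessibility of a named world becomes membership
of the single formula `⟨π⟩y`. -/
theorem CanRel.of_nom (hΓ : IsNamed Γ) (hΔ : IsWorld Γ Δ) (hΔ' : IsWorld Γ Δ')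
    {π : Program Atm Nom Agt Act} {y : Nom} (hy : nom y ∈ Δ') (h : box π (neg (nom y)) ∉ Δ) :
    CanRel π Δ Δ' := by
  intro φ hφ
  obtain ⟨π₁, -, rfl⟩ := hΔ'.eq_stateAt hΓ hy
  obtain ⟨π₀, x, -, rfl⟩ := hΔ
  rw [mem_stateAt, ← hΓ.box_seq_test_seq] at h hφ
  exact hΓ.box_imp_nom_of_box h (hΓ.box_mono hφ (.of_taut (by
    intro val hn ha; simp only [imp, hn, ha]; tauto))) π₁

theorem CanRel.box_neg_nom (hΔ' : IsMCS Δ') {π : Program Atm Nom Agt Act} (h : CanRel π Δ Δ')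
    {y : Nom} (hy : nom y ∈ Δ') : box π (neg (nom y)) ∉ Δ :=
  fun h' => (hΔ'.neg_mem _).1 (h _ h') hy

theorem IsWorld.exists_canRel (hΓ : IsNamed Γ) (hΔ : IsWorld Γ Δ) {π : Program Atm Nom Agt Act}
    {φ : Formula Atm Nom Agt Act} (h : box π φ ∉ Δ) :
    ∃ Δ', IsWorld Γ Δ' ∧ CanRel π Δ Δ' ∧ φ ∉ Δ' := by
  have hN := hΔ.isNamed hΓ
  -- Asking for a name of a `π;(¬φ)?`-successor, rather than a `π`-successor, ensures that the named
  -- state refutes `φ`.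
  have h₁ : box (seq π (test (neg φ))) bot ∉ Δ := fun h' => h (hN.box_mono
    ((hN.box_seq_test _ _ _).1 h') (.of_taut (by
      intro val hn ha; simp only [imp, bot, hn, ha]; tauto)))
  obtain ⟨y, hy⟩ := hN.exists_nom _ h₁
  rw [hN.box_seq_test] at hy
  have hy' : box π (neg (nom y)) ∉ Δ := fun h' => hy (hN.box_mono h' (.of_taut (by
    intro val hn ha; simp only [imp, hn, ha]; tauto)))
  obtain ⟨π₀, x, hx, hΔx⟩ := id hΔ
  -- The successor has to be presented from `Γ`: go to `Δ` by `π₀;x?`, then follow `π`.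
  have hw : IsWorld Γ (stateAt Γ (seq (seq π₀ (test (nom x))) π) y) := by
    refine ⟨_, y, fun h' => hy' ?_, rfl⟩
    rwa [hΔx, mem_stateAt, ← hΓ.box_seq_test_seq]
  refine ⟨_, hw, .of_nom hΓ hΔ hw (hΓ.nom_mem_stateAt _ y) hy', fun h' => hy ?_⟩
  rw [mem_stateAt, hΓ.box_seq_test_seq, ← mem_stateAt, ← hΔx] at h'
  exact hN.box_mono h' (.of_taut (by intro val hn ha; simp only [imp, hn, ha]; tauto))

theorem IsWorld.exists_canRel_of_dia (hΓ : IsNamed Γ) (hΔ : IsWorld Γ Δ)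
    {π : Program Atm Nom Agt Act} {φ : Formula Atm Nom Agt Act} (h : dia π φ ∈ Δ) :
    ∃ Δ', IsWorld Γ Δ' ∧ CanRel π Δ Δ' ∧ φ ∈ Δ' := by
  obtain ⟨Δ', hw, hR, hφ⟩ :=
    hΔ.exists_canRel hΓ (((hΔ.isNamed hΓ).mem_dia _ _).1 h)
  exact ⟨Δ', hw, hR, by rwa [(hw.isNamed hΓ).neg_mem, not_not] at hφ⟩

theorem CanRel.dia_mem (hΔ : IsMCS Δ) (hΔ' : IsMCS Δ') {π : Program Atm Nom Agt Act}
    (h : CanRel π Δ Δ') {φ : Formula Atm Nom Agt Act} (hφ : φ ∈ Δ') : dia π φ ∈ Δ :=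
  (hΔ.mem_dia _ _).2 fun h' => (hΔ'.neg_mem _).1 (h _ h') hφ

theorem IsWorld.countable [Countable Atm] [Countable Nom] :
    {Δ | IsWorld Γ Δ}.Countable := by
  have hprog : Countable (Program Atm Nom Agt Act) :=
    Function.Injective.countable (f := fun π => box π bot) fun π π' h => by cases h; rfl
  refine (Set.countable_range fun p : Program Atm Nom Agt Act × Nom =>
    stateAt Γ p.1 p.2).mono ?_
  rintro _ ⟨π, x, -, rfl⟩
  exact ⟨(π, x), rfl⟩

end Worlds

-- Canonical relations of the program constructors

section CanonicalRelations

variable {Γ Δ Δ' Δ'' : Set (Formula Atm Nom Agt Act)}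

theorem IsMCS.canRel_pre_refl (hΔ : IsMCS Δ) (i : Agt) (τ : Kind) : CanRel (pre i τ) Δ Δ :=
  fun φ => (hΔ.mem_imp _ _).1 (hΔ.mem_of_axiom (.t_pre i τ φ))

theorem CanRel.pre_trans (hΔ : IsMCS Δ) {i : Agt} {τ : Kind} (h : CanRel (pre i τ) Δ Δ')
    (h' : CanRel (pre i τ) Δ' Δ'') : CanRel (pre i τ) Δ Δ'' :=
  fun φ hφ => h' _ (h _ ((hΔ.mem_imp _ _).1 (hΔ.mem_of_axiom (.four_pre i τ φ)) hφ))

theorem CanRel.equiv_of_pre (hΔ : IsMCS Δ) {i : Agt} {τ : Kind} (h : CanRel (pre i τ) Δ Δ') :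
    CanRel (equiv i) Δ Δ' :=
  fun φ hφ => h _ ((hΔ.mem_imp _ _).1 (hΔ.mem_of_axiom (.inc i τ φ)) hφ)

theorem IsMCS.canRel_equiv_refl (hΔ : IsMCS Δ) (i : Agt) : CanRel (equiv i) Δ Δ :=
  fun φ => (hΔ.mem_imp _ _).1 (hΔ.mem_of_axiom (.t_equiv i φ))

theorem CanRel.equiv_trans (hΔ : IsMCS Δ) {i : Agt} (h : CanRel (equiv i) Δ Δ')
    (h' : CanRel (equiv i) Δ' Δ'') : CanRel (equiv i) Δ Δ'' :=
  fun φ hφ => h' _ (h _ ((hΔ.mem_imp _ _).1 (hΔ.mem_of_axiom (.four_equiv i φ)) hφ))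

theorem CanRel.equiv_symm (hΔ : IsMCS Δ) (hΔ' : IsMCS Δ') {i : Agt}
    (h : CanRel (equiv i) Δ Δ') : CanRel (equiv i) Δ' Δ := by
  intro φ hφ
  by_contra hn
  have h₁ : neg (box (equiv i) φ) ∈ Δ :=
    (hΔ.neg_mem _).2 fun h₂ => hn (hΔ.canRel_equiv_refl i φ h₂)
  exact (hΔ'.neg_mem _).1
    (h _ ((hΔ.mem_imp _ _).1 (hΔ.mem_of_axiom (.five_equiv i φ)) h₁)) hφ

theorem CanRel.pre_total (hΓ : IsNamed Γ) (hΔ : IsWorld Γ Δ) (hΔ' : IsWorld Γ Δ') {i : Agt}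
    (τ : Kind) (h : CanRel (equiv i) Δ Δ') :
    CanRel (pre i τ) Δ Δ' ∨ CanRel (pre i τ) Δ' Δ := by
  -- The world witnessing the diamond carries the name `x`, hence is `Δ` itself. The union in the
  -- hypothesis lets the same claim serve with the two worlds exchanged, the diamond then lying in
  -- the second one.
  have key : ∀ {Δ Δ'}, IsWorld Γ Δ → IsWorld Γ Δ' → ∀ {x y}, nom x ∈ Δ → nom y ∈ Δ' →
      dia (equiv i) (and (nom x) (dia (pre i τ) (nom y))) ∈ Δ ∪ Δ' → CanRel (pre i τ) Δ Δ' := by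
    intro Δ Δ' hΔ hΔ' x y hx hy hd
    obtain ⟨Δ₁, hΔ₁, hm⟩ : ∃ Δ₁, IsWorld Γ Δ₁ ∧ and (nom x) (dia (pre i τ) (nom y)) ∈ Δ₁ := by
      rcases hd with hd | hd
      · obtain ⟨Δ₁, hΔ₁, -, hm⟩ := hΔ.exists_canRel_of_dia hΓ hd
        exact ⟨Δ₁, hΔ₁, hm⟩
      · obtain ⟨Δ₁, hΔ₁, -, hm⟩ := hΔ'.exists_canRel_of_dia hΓ hd
        exact ⟨Δ₁, hΔ₁, hm⟩
    have hN := hΔ₁.isNamed hΓ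
    rw [hN.and_mem, hN.mem_dia] at hm
    obtain rfl := hΔ₁.eq_of_nom hΓ hΔ hm.1 hx
    exact .of_nom hΓ hΔ₁ hΔ' hy hm.2
  have hN := hΔ.isNamed hΓ
  obtain ⟨x, hx⟩ := hΔ.exists_nom hΓ
  obtain ⟨y, hy⟩ := hΔ'.exists_nom hΓ
  have hc := (hN.mem_imp _ _).1 (hN.mem_of_axiom (.conn i τ (nom x) (nom y)))
    ((hN.and_mem _ _).2 ⟨(hN.canRel_equiv_refl i).dia_mem hN.toIsMCS hN.toIsMCS hx,
      h.dia_mem hN.toIsMCS (hΔ'.isNamed hΓ).toIsMCS hy⟩)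
  rcases (hN.mem_or _ _).1 hc with hc | hc
  · exact .inl (key hΔ hΔ' hx hy (.inl hc))
  · exact .inr (key hΔ' hΔ hy hx (.inr hc))

/-- For `y` naming `Δ'`, `comp1` says that reaching `y` by `≡` means reaching it by `≼` or by its
complement, and `comp2` that both cannot happen. -/
theorem canRel_preCompl (hΓ : IsNamed Γ) (hΔ : IsWorld Γ Δ) (hΔ' : IsWorld Γ Δ') (i : Agt)
    (τ : Kind) :
    CanRel (preCompl i τ) Δ Δ' ↔ CanRel (equiv i) Δ Δ' ∧ ¬ CanRel (pre i τ) Δ Δ' := by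
  have hN := hΔ.isNamed hΓ
  have hN' := hΔ'.isNamed hΓ
  obtain ⟨y, hy⟩ := hΔ'.exists_nom hΓ
  have hc : ∀ φ, (box (pre i τ) φ ∈ Δ ∧ box (preCompl i τ) φ ∈ Δ) ↔ box (equiv i) φ ∈ Δ :=
    fun φ => by rw [← hN.and_mem, ← hN.mem_iff]; exact hN.mem_of_axiom (.comp1 i τ φ)
  refine ⟨fun h => ⟨fun φ hφ => h _ ((hc φ).2 hφ).2, fun h' => ?_⟩, fun ⟨h, h'⟩ => ?_⟩
  · exact h.box_neg_nom hN'.toIsMCS hy ((hN.mem_imp _ _).1 (hN.mem_of_axiom (.comp2 i τ y))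
      (h'.dia_mem hN.toIsMCS hN'.toIsMCS hy))
  · refine .of_nom hΓ hΔ hΔ' hy fun h₁ => h.box_neg_nom hN'.toIsMCS hy ((hc _).1 ⟨?_, h₁⟩)
    by_contra h₂
    exact h' (.of_nom hΓ hΔ hΔ' hy h₂)

theorem canRel_seq (hΓ : IsNamed Γ) (hΔ : IsWorld Γ Δ) (hΔ' : IsWorld Γ Δ')
    (π π' : Program Atm Nom Agt Act) :
    CanRel (seq π π') Δ Δ' ↔ ∃ Δ₁, IsWorld Γ Δ₁ ∧ CanRel π Δ Δ₁ ∧ CanRel π' Δ₁ Δ' := by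
  have hN := hΔ.isNamed hΓ
  obtain ⟨y, hy⟩ := hΔ'.exists_nom hΓ
  refine ⟨fun h => ?_, fun ⟨Δ₁, hΔ₁, h, h'⟩ φ hφ => h' _ (h _ ((hN.box_seq _ _ _).1 hφ))⟩
  have h₁ := h.box_neg_nom (hΔ'.isNamed hΓ).toIsMCS hy
  rw [hN.box_seq] at h₁
  obtain ⟨Δ₁, hΔ₁, hR, hφ⟩ := hΔ.exists_canRel hΓ h₁
  exact ⟨Δ₁, hΔ₁, hR, .of_nom hΓ hΔ₁ hΔ' hy hφ⟩

theorem canRel_union (hΓ : IsNamed Γ) (hΔ : IsWorld Γ Δ) (hΔ' : IsWorld Γ Δ')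
    (π π' : Program Atm Nom Agt Act) :
    CanRel (union π π') Δ Δ' ↔ CanRel π Δ Δ' ∨ CanRel π' Δ Δ' := by
  have hN := hΔ.isNamed hΓ
  obtain ⟨y, hy⟩ := hΔ'.exists_nom hΓ
  have hc : ∀ φ, box (union π π') φ ∈ Δ ↔ (box π φ ∈ Δ ∧ box π' φ ∈ Δ) :=
    fun φ => by rw [← hN.and_mem, ← hN.mem_iff]; exact hN.mem_of_axiom (.red_union π π' φ)
  refine ⟨fun h => ?_, fun h φ hφ => h.elim (fun h => h _ ((hc φ).1 hφ).1)
    fun h => h _ ((hc φ).1 hφ).2⟩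
  have h₁ := h.box_neg_nom (hΔ'.isNamed hΓ).toIsMCS hy
  rw [hc, not_and_or] at h₁
  exact h₁.imp (.of_nom hΓ hΔ hΔ' hy) (.of_nom hΓ hΔ hΔ' hy)

theorem canRel_inter (hΓ : IsNamed Γ) (hΔ : IsWorld Γ Δ) (hΔ' : IsWorld Γ Δ')
    (π π' : Program Atm Nom Agt Act) :
    CanRel (inter π π') Δ Δ' ↔ CanRel π Δ Δ' ∧ CanRel π' Δ Δ' := by
  have hN := hΔ.isNamed hΓ
  have hN' := hΔ'.isNamed hΓ
  obtain ⟨y, hy⟩ := hΔ'.exists_nom hΓ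
  have htop : ∀ π, box π top ∈ Δ := fun π => hN.mem_of_provable (.nec _ _ (.of_taut (by
    intro val hn ha; simp only [top, bot, hn, ha]; tauto)))
  have hc : ∀ φ ψ, box π φ ∈ Δ → box π' ψ ∈ Δ → box (inter π π') (and φ ψ) ∈ Δ := fun φ ψ h h' =>
    (hN.mem_imp _ _).1 (hN.mem_of_axiom (.add1_inter π π' φ ψ)) ((hN.and_mem _ _).2 ⟨h, h'⟩)
  refine ⟨fun h => ⟨fun φ hφ => ((hN'.and_mem _ _).1 (h _ (hc φ top hφ (htop π')))).1,
    fun φ hφ => ((hN'.and_mem _ _).1 (h _ (hc top φ (htop π) hφ))).2⟩, fun ⟨h, h'⟩ => ?_⟩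
  -- Here the name is essential: diamonds combine under intersection only when both point at the
  -- same nominal.
  refine .of_nom hΓ hΔ hΔ' hy ((hN.mem_dia _ _).1 ?_)
  exact (hN.mem_imp _ _).1 (hN.mem_of_axiom (.add2_inter π π' y)) ((hN.and_mem _ _).2
    ⟨h.dia_mem hN.toIsMCS hN'.toIsMCS hy, h'.dia_mem hN.toIsMCS hN'.toIsMCS hy⟩)

theorem canRel_conv (hΔ : IsMCS Δ) (hΔ' : IsMCS Δ') (π : Program Atm Nom Agt Act) :
    CanRel (conv π) Δ Δ' ↔ CanRel π Δ' Δ := by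
  constructor
  · intro h φ hφ
    by_contra hn
    have := h _ ((hΔ.mem_imp _ _).1 (hΔ.mem_of_axiom (.conv2 π (neg φ))) ((hΔ.neg_mem _).2 hn))
    exact (hΔ'.mem_dia _ _).1 this (hΔ'.box_mono hφ (.of_taut (by
      intro val hn ha; simp only [imp, hn, ha]; tauto)))
  · intro h φ hφ
    by_contra hn
    have := h _ ((hΔ'.mem_imp _ _).1 (hΔ'.mem_of_axiom (.conv1 π (neg φ))) ((hΔ'.neg_mem _).2 hn))
    exact (hΔ.mem_dia _ _).1 this (hΔ.box_mono hφ (.of_taut (by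
      intro val hn ha; simp only [imp, hn, ha]; tauto)))

theorem canRel_test (hΓ : IsNamed Γ) (hΔ : IsWorld Γ Δ) (hΔ' : IsWorld Γ Δ')
    (φ : Formula Atm Nom Agt Act) : CanRel (test φ) Δ Δ' ↔ Δ = Δ' ∧ φ ∈ Δ := by
  have hN := hΔ.isNamed hΓ
  obtain ⟨y, hy⟩ := hΔ'.exists_nom hΓ
  have hc : ∀ ψ, box (test φ) ψ ∈ Δ ↔ (φ ∈ Δ → ψ ∈ Δ) :=
    fun ψ => by rw [← hN.mem_imp, ← hN.mem_iff]; exact hN.mem_of_axiom (.red_test φ ψ)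
  refine ⟨fun h => ?_, fun ⟨h, hφ⟩ ψ hψ => h ▸ (hc ψ).1 hψ hφ⟩
  have h₁ := h.box_neg_nom (hΔ'.isNamed hΓ).toIsMCS hy
  rw [hc, hN.neg_mem] at h₁
  push Not at h₁
  exact ⟨hΔ.eq_of_nom hΓ hΔ' h₁.2 hy, h₁.1⟩

theorem IsMCS.exists_play (hΔ : IsMCS Δ) (i : Agt) : ∃ a, play i a ∈ Δ := by
  obtain ⟨a, -, ha⟩ := (hΔ.mem_bigOr _ _).1 (hΔ.mem_of_provable (.ax_choice _ (.leastAct i)))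
  exact ⟨a, ha⟩

theorem IsMCS.play_unique (hΔ : IsMCS Δ) {i : Agt} {a b : Act} (ha : play i a ∈ Δ)
    (hb : play i b ∈ Δ) : a = b := by
  by_contra hab
  exact (hΔ.neg_mem _).1 ((hΔ.mem_imp _ _).1
    (hΔ.mem_of_provable (.ax_choice _ (.mostAct i a b hab))) ha) hb

end CanonicalRelations

-- Canonical model and truth lemma

section CanonicalModel

variable {Γ : Set (Formula Atm Nom Agt Act)} (hΓ : IsNamed Γ) {W : Type v}
  (T : W ≃ {Δ | IsWorld Γ Δ})

/-- The canonical model generated by `Γ`, with an arbitrary type `W` of labels for the worlds. -/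
noncomputable abbrev canonicalModel : MCMC.{u₁, u₂, u₃, u₄, v} Atm Nom Agt Act where
  W := W
  pre i τ w v := CanRel (pre i τ) (T w).1 (T v).1
  equiv i w v := CanRel (equiv i) (T w).1 (T v).1
  V w := {s | Sum.elim (fun p => atom p ∈ (T w).1) (fun x => nom x ∈ (T w).1) s}
  pre_refl i τ w := ((T w).2.isNamed hΓ).canRel_pre_refl i τ
  pre_trans i τ w _ _ h h' := h.pre_trans ((T w).2.isNamed hΓ).toIsMCS h'
  equiv_equivalence i :=
    { refl := fun w => ((T w).2.isNamed hΓ).canRel_equiv_refl i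
      symm := fun {w v} h =>
        h.equiv_symm ((T w).2.isNamed hΓ).toIsMCS ((T v).2.isNamed hΓ).toIsMCS
      trans := fun {w _ _} h h' => h.equiv_trans ((T w).2.isNamed hΓ).toIsMCS h' }
  c1 i τ w _ h := h.equiv_of_pre ((T w).2.isNamed hΓ).toIsMCS
  c2 i τ w v h := h.pre_total hΓ (T w).2 (T v).2 τ
  c3 w := (T w).2.exists_nom hΓ
  c4 w v h := by
    obtain ⟨x, hx, hx'⟩ := h
    exact T.injective (Subtype.ext ((T w).2.eq_of_nom hΓ (T v).2 hx hx'))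
  C i w := (((T w).2.isNamed hΓ).exists_play i).choose
  c5 i δ w h := by
    have hN := (T w).2.isNamed hΓ
    -- Each separately possible choice gives `⟨≡_i⟩play(j, δ j)` at `w`; (SIC) merges them, and the
    -- existence lemma supplies the common world.
    have h₁ := (hN.mem_imp _ _).1 (hN.mem_of_provable (.ax_choice _ (.sic i δ)))
      ((hN.mem_bigAnd _ _).2 fun j _ => by
        obtain ⟨w', hw, hj⟩ := h j
        refine hw.dia_mem hN.toIsMCS ((T w').2.isNamed hΓ).toIsMCS ?_
        rw [← hj]
        exact (((T w').2.isNamed hΓ).exists_play j).choose_spec)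
    obtain ⟨Δ, hΔ, hR, hφ⟩ := (T w).2.exists_canRel_of_dia hΓ h₁
    obtain ⟨v, hv⟩ := T.surjective ⟨Δ, hΔ⟩
    have hv' : (T v).1 = Δ := congrArg Subtype.val hv
    refine ⟨v, hv' ▸ hR, fun j => ((T v).2.isNamed hΓ).play_unique
      (((T v).2.isNamed hΓ).exists_play j).choose_spec ?_⟩
    rw [hv']
    exact ((hΔ.isNamed hΓ).mem_bigAnd _ _).1 hφ j (Finset.mem_univ j)

mutual
  -- Proved simultaneously with the truth lemma, since tests contain formulas and boxes contain
  -- programs.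
  theorem rel_canonicalModel : ∀ (π : Program Atm Nom Agt Act) (w v : W),
      Rel (canonicalModel hΓ T) π w v ↔ CanRel π (T w).1 (T v).1
    | .equiv i, w, v => by simp only [Rel]
    | .pre i τ, w, v => by simp only [Rel]
    | .preCompl i τ, w, v => by
      rw [canRel_preCompl hΓ (T w).2 (T v).2]; simp only [Rel]
    | .seq π π', w, v => by
      rw [canRel_seq hΓ (T w).2 (T v).2, Rel]
      constructor
      · rintro ⟨u, h, h'⟩
        exact ⟨(T u).1, (T u).2, (rel_canonicalModel π w u).1 h, (rel_canonicalModel π' u v).1 h'⟩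
      · rintro ⟨Δ, hΔ, h, h'⟩
        obtain ⟨u, hu⟩ := T.surjective ⟨Δ, hΔ⟩
        have hu' : (T u).1 = Δ := congrArg Subtype.val hu
        exact ⟨u, (rel_canonicalModel π w u).2 (hu' ▸ h), (rel_canonicalModel π' u v).2 (hu' ▸ h')⟩
    | .union π π', w, v => by
      rw [canRel_union hΓ (T w).2 (T v).2, Rel, rel_canonicalModel π w v,
        rel_canonicalModel π' w v]
    | .inter π π', w, v => by
      rw [canRel_inter hΓ (T w).2 (T v).2, Rel, rel_canonicalModel π w v,
        rel_canonicalModel π' w v]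
    | .conv π, w, v => by
      rw [canRel_conv ((T w).2.isNamed hΓ).toIsMCS ((T v).2.isNamed hΓ).toIsMCS, Rel,
        rel_canonicalModel π v w]
    | .test φ, w, v => by
      rw [canRel_test hΓ (T w).2 (T v).2, Rel, sat_canonicalModel φ w, Subtype.val_inj,
        T.injective.eq_iff]

  theorem sat_canonicalModel : ∀ (φ : Formula Atm Nom Agt Act) (w : W),
      Sat (canonicalModel hΓ T) φ w ↔ φ ∈ (T w).1
    | .atom p, w => by simp only [Sat]; exact Iff.rfl
    | .nom x, w => by simp only [Sat]; exact Iff.rfl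
    | .play i a, w => by
      have hN := (T w).2.isNamed hΓ
      simp only [Sat]
      exact ⟨fun h => h ▸ (hN.exists_play i).choose_spec,
        fun h => hN.play_unique (hN.exists_play i).choose_spec h⟩
    | .neg φ, w => by
      rw [((T w).2.isNamed hΓ).neg_mem, sat_neg, sat_canonicalModel φ w]
    | .and φ ψ, w => by
      rw [((T w).2.isNamed hΓ).and_mem, sat_and, sat_canonicalModel φ w, sat_canonicalModel ψ w]
    | .box π φ, w => by
      rw [sat_box]
      constructor
      · intro h
        by_contra hn
        obtain ⟨Δ, hΔ, hR, hφ⟩ := (T w).2.exists_canRel hΓ hn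
        obtain ⟨u, hu⟩ := T.surjective ⟨Δ, hΔ⟩
        have hu' : (T u).1 = Δ := congrArg Subtype.val hu
        exact hφ (hu' ▸ (sat_canonicalModel φ u).1
          (h u ((rel_canonicalModel π w u).2 (hu' ▸ hR))))
      · exact fun h v hv => (sat_canonicalModel φ v).2 ((rel_canonicalModel π w v).1 hv _ h)
end

end CanonicalModel

theorem Valid.provable [Countable Atm] [Countable Nom] {φ : Formula Atm Nom Agt Act}
    (h : Valid.{u₁, u₂, u₃, u₄, v} φ) : Provable φ := by
  by_contra hφ
  have hcons : Consistent (neg φ) := fun h' => hφ (h'.taut_mp (by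
    intro val hn ha; simp only [imp, hn, ha]; tauto))
  obtain ⟨Γ, hΓ, hmem⟩ := exists_isNamed hcons
  have : Countable {Δ | IsWorld Γ Δ} := (IsWorld.countable (Γ := Γ)).to_subtype
  -- There are countably many worlds, so they can be relabelled by a type in whatever universe
  -- `Valid` quantifies over.
  let T := (equivShrink.{v} {Δ | IsWorld Γ Δ}).symm
  have htest : box (test top) φ ∉ Γ := fun h' => (hΓ.neg_mem _).1 hmem
    ((hΓ.mem_imp _ _).1 ((hΓ.mem_iff _ _).1 (hΓ.mem_of_axiom (.red_test top φ)) |>.1 h')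
      hΓ.top_mem)
  -- The refuting point must be exhibited as a named state. The program `⊤?;(¬φ)?` is executable at
  -- `Γ`, and every state it reaches satisfies `¬φ`.
  have hseq : box (seq (test top) (test (neg φ))) bot ∉ Γ := fun h' => htest
    (hΓ.box_mono ((hΓ.box_seq_test _ _ _).1 h') (.of_taut (by
      intro val hn ha; simp only [imp, bot, hn, ha]; tauto)))
  obtain ⟨x, hx⟩ := hΓ.exists_nom _ hseq
  have hw : IsWorld Γ (stateAt Γ (seq (test top) (test (neg φ))) x) := ⟨_, x, hx, rfl⟩
  have hneg : neg φ ∈ stateAt Γ (seq (test top) (test (neg φ))) x :=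
    (hΓ.box_seq_test _ _ _).2 (hΓ.mem_of_provable (.nec _ _ (.of_taut (by
      intro val hn ha; simp only [imp, hn, ha]; tauto))))
  have hsat := (sat_canonicalModel hΓ T φ (T.symm ⟨_, hw⟩)).1 (h _ _)
  rw [Equiv.apply_symm_apply] at hsat
  exact ((hw.isNamed hΓ).neg_mem _).1 hneg hsat

end DLCAG

theorem mainTheorem2
    {Atm : Type u₁} {Nom : Type u₂} {Agt : Type u₃} {Act : Type u₄}
    [Countable Atm] [Infinite Atm] [Countable Nom] [Infinite Nom] [Fintype Agt] [Fintype Act]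
    (φ : DLCAG.Formula Atm Nom Agt Act) :
    DLCAG.Provable φ ↔ DLCAG.Valid.{u₁, u₂, u₃, u₄, v} φ :=
  ⟨DLCAG.Provable.valid, DLCAG.Valid.provable⟩
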